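/- Let $X$ and $Y_1,\dots,Y_n$ be finite-dimensional real Hilbert spaces, $Y=\prod_{i=1}^n Y_i$, let $A_i:X\to Y_i$ be linear operators with operator norms $\|A_i\|$ and adjoints $A_i^T$, and let $g:X\to\mathbb{R}\cup\{\infty\}$ and $f_i:Y_i\to\mathbb{R}\cup\{\infty\}$ be convex, proper and lower semicontinuous, with convex conjugates $f_i^*(y)=\sup_{u\in Y_i}\langle u,y\rangle-f_i(u)$. For a convex, proper and lower semicontinuous functional $h$ and $\sigma>0$ put $\mathrm{prox}_{\sigma h}(v)=\arg\min_u \frac{\|v-u\|^2}{2}+\sigma h(u)$. A pair $(\hat x,\hat y)\in X\times Y$ is a saddle point of $$\min_{x\in X}\max_{y\in Y}\ L(x,y),\qquad L(x,y)=\sum_{i=1}^n\big(\langle A_ix,y_i\rangle-f_i^*(y_i)\big)+g(x),$$ if $L(\hat x,y)\le L(\hat x,\hat y)\le L(x,\hat y)$ for all $x\in X$ and $y\in Y$. Assume that a saddle point exists. Let $p_1,\dots,p_n>0$, and let $j^0,j^1,\dots$ be independent random indices in $\{1,\dots,n\}$ with $\mathbb{P}(j^k=i)=p_i$ for all $k$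 and $i$. Let the step sizes $\tau,\sigma_1,\dots,\sigma_n>0$ satisfy $$\tau\sigma_i\|A_i\|^2<p_i\quad\text{for every } i.$$ Choose $x^0\in X$, set $y^0=0\in Y$ and $z^0=\bar z^0=0\in X$, and for $k\ge 0$ let $$x^{k+1}=\mathrm{prox}_{\tau g}(x^k-\tau\bar z^k),\qquad y_i^{k+1}=\begin{cases}\mathrm{prox}_{\sigma_i f_i^*}(y_i^k+\sigma_iA_ix^{k+1}) & \text{if } i=j^k,\\ y_i^k & \text{otherwise,}\end{cases}$$ $$\delta^k=A_{j^k}^T\big(y_{j^k}^{k+1}-y_{j^k}^k\big),\qquad z^{k+1}=z^k+\delta^k,\qquad \bar z^{k+1}=z^{k+1}+p_{j^k}^{-1}\delta^k .$$ Then, almost surely, the sequence $(x^k,y^k)_{k\in\mathbb{N}}$ converges to a saddle point (which may depend on the realization). -/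

import Mathlib

open MeasureTheory ProbabilityTheory Filter Topology

namespace SPDHG

/-- A proper functional with values in `ℝ ∪ {∞}`: it never takes the value `-∞` and is finite
somewhere. -/
def IsProper {E : Type*} (f : E → EReal) : Prop :=
  (∀ x, f x ≠ ⊥) ∧ ∃ x, f x ≠ ⊤

/-- Convexity of an extended-real-valued functional, by the usual inequality. -/
def IsConvex {E : Type*} [AddCommGroup E] [Module ℝ E] (f : E → EReal) : Prop :=
  ∀ x y : E, ∀ a b : ℝ, 0 < a → 0 < b → a + b = 1 →
    f (a • x + b • y) ≤ (a : EReal) * f x + (b : EReal) * f y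

/-- The convex conjugate `f^*(y) = sup_x ⟨x, y⟩ - f(x)`. -/
noncomputable def conj {E : Type*} [NormedAddCommGroup E] [InnerProductSpace ℝ E]
    (f : E → EReal) (y : E) : EReal :=
  ⨆ x : E, ((inner ℝ x y : ℝ) : EReal) - f x

/-- `u` minimizes `‖v - u‖² / 2 + σ f(u)`. -/
def IsProx {E : Type*} [NormedAddCommGroup E] (σ : ℝ) (f : E → EReal) (v u : E) : Prop :=
  ∀ u' : E, ((‖v - u‖ ^ 2 / 2 : ℝ) : EReal) + (σ : EReal) * f u
    ≤ ((‖v - u'‖ ^ 2 / 2 : ℝ) : EReal) + (σ : EReal) * f u'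

/-- The proximity operator `prox_{σ f}(v) = argmin_u ‖v - u‖² / 2 + σ f(u)`. The minimizer exists
and is unique when `σ > 0`, `f` is convex, proper and lower semicontinuous and `E` is complete. -/
noncomputable def prox {E : Type*} [NormedAddCommGroup E] (σ : ℝ) (f : E → EReal) (v : E) : E :=
  Classical.epsilon fun u => IsProx σ f v u

/-- The saddle function `∑ i, (⟨A_i x, y_i⟩ - f_i^*(y_i)) + g(x)`. -/
noncomputable def lagrangian {n : ℕ} {X : Type*} {Y : Fin n → Type*}
    [NormedAddCommGroup X] [InnerProductSpace ℝ X]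
    [∀ i, NormedAddCommGroup (Y i)] [∀ i, InnerProductSpace ℝ (Y i)]
    (A : ∀ i, X →L[ℝ] Y i) (f : ∀ i, Y i → EReal) (g : X → EReal)
    (x : X) (y : ∀ i, Y i) : EReal :=
  (∑ i, (((inner ℝ (A i x) (y i) : ℝ) : EReal) - conj (f i) (y i))) + g x

/-- `w = (x, y)` is a saddle point: `y` maximizes the saddle function at `x`, and `x` minimizes
it at `y`. -/
def IsSaddlePoint {n : ℕ} {X : Type*} {Y : Fin n → Type*}
    [NormedAddCommGroup X] [InnerProductSpace ℝ X]
    [∀ i, NormedAddCommGroup (Y i)] [∀ i, InnerProductSpace ℝ (Y i)]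
    (A : ∀ i, X →L[ℝ] Y i) (f : ∀ i, Y i → EReal) (g : X → EReal)
    (w : X × (∀ i, Y i)) : Prop :=
  (∀ y, lagrangian A f g w.1 y ≤ lagrangian A f g w.1 w.2) ∧
    ∀ x, lagrangian A f g w.1 w.2 ≤ lagrangian A f g x w.2

/-- The variables `x^k, y^k, z^k, z̄^k` held by the algorithm. -/
structure State {n : ℕ} (X : Type*) (Y : Fin n → Type*) where
  x : X
  y : ∀ i, Y i
  z : X
  zbar : X

/-- One iteration, with selected index `j`. -/
noncomputable def step {n : ℕ} {X : Type*} {Y : Fin n → Type*}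
    [NormedAddCommGroup X] [InnerProductSpace ℝ X] [CompleteSpace X]
    [∀ i, NormedAddCommGroup (Y i)] [∀ i, InnerProductSpace ℝ (Y i)] [∀ i, CompleteSpace (Y i)]
    (A : ∀ i, X →L[ℝ] Y i) (f : ∀ i, Y i → EReal) (g : X → EReal)
    (τ : ℝ) (σ p : Fin n → ℝ) (j : Fin n) (s : State X Y) : State X Y :=
  let x' : X := prox τ g (s.x - τ • s.zbar)
  let y' : ∀ i, Y i :=
    Function.update s.y j (prox (σ j) (conj (f j)) (s.y j + σ j • A j x'))
  let δ : X := ContinuousLinearMap.adjoint (A j) (y' j - s.y j)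
  let z' : X := s.z + δ
  { x := x', y := y', z := z', zbar := z' + (p j)⁻¹ • δ }

/-- The iterates started at `x⁰ = x₀`, `y⁰ = 0`, `z⁰ = z̄⁰ = 0`, along the sequence `j` of selected
indices. -/
noncomputable def iterate {n : ℕ} {X : Type*} {Y : Fin n → Type*}
    [NormedAddCommGroup X] [InnerProductSpace ℝ X] [CompleteSpace X]
    [∀ i, NormedAddCommGroup (Y i)] [∀ i, InnerProductSpace ℝ (Y i)] [∀ i, CompleteSpace (Y i)]
    (A : ∀ i, X →L[ℝ] Y i) (f : ∀ i, Y i → EReal) (g : X → EReal)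
    (τ : ℝ) (σ p : Fin n → ℝ) (x₀ : X) (j : ℕ → Fin n) : ℕ → State X Y
  | 0 => { x := x₀, y := 0, z := 0, zbar := 0 }
  | k + 1 => step A f g τ σ p (j k) (iterate A f g τ σ p x₀ j k)

end SPDHG

/-!
The proximity operators of functionals of class `Γ₀` are the resolvents of their subdifferentials,
so they are firmly nonexpansive, and the saddle points are exactly the common fixed points of the
primal and dual updates (`isSaddlePoint_iff_prox`). From there on only firm nonexpansiveness is used.

Since `y⁰ = 0` and `z⁰ = 0`, the iteration keeps `z^k = Aᵀ y^k`, and `e^k = z̄^k - z^k` is the error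
of the extrapolation. For a saddle point `(x̂, ŷ)` consider the Lyapunov function
`‖x - x̂‖² / (2τ) + ∑ i, ‖y_i - ŷ_i‖² / (2 p_i σ_i) - ⟨x - x̂, e⟩ + τ ‖e‖² / (2γ)`,
where `γ < 1` satisfies `τ σ_i ‖A_i‖² ≤ γ² p_i`. Let `v` be the dual variable that results from
updating all components at once. The average of `e^{k+1}` over the index `j^k` is `Aᵀ (v - y^k)`, so
the coupling terms of the primal and the dual inequality cancel on average, up to products of small
quantities that the step size condition absorbs. Hence the Lyapunov function decreases on average by
a multiple of `‖x^{k+1} - x^k‖² / τ + ∑ i, ‖v_i - y_i^k‖² / σ_i` (`sum_lyapunov_step_le`).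

By independence of the indices the Lyapunov function is therefore a nonnegative supermartingale, and
almost surely it converges and its decrease vanishes (`ae_tendsto_of_average_add_le`). A vanishing
decrease makes `e^k` vanish, so the weighted distance to the saddle point converges
(`exists_tendsto_weightedSqDist`), and makes all cluster points fixed points of the updates
(`isSaddlePoint_of_cluster`). These almost sure statements hold simultaneously for a countable dense
set of saddle points, which suffices for Opial's argument (`exists_tendsto_of_cluster_mem`): the
sequence converges to a saddle point.
-/

namespace SPDHG

/-! ### Functionals of independent random indices -/

section RandomIndices

variable {n : ℕ} {Ω : Type*}

/-- The first `k` selected indices. -/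
def history (j : ℕ → Ω → Fin n) (k : ℕ) (ω : Ω) : Finset.range k → Fin n :=
  fun m => j m ω

/-- Functionals of an index sequence that are determined by its first `k` terms. -/
def Nonanticipating (V : ℕ → (ℕ → Fin n) → ℝ) : Prop :=
  ∀ k a b, (∀ m < k, a m = b m) → V k a = V k b

/-- A nonanticipating functional is, at time `k`, a function of the first `k` indices. -/
lemma Nonanticipating.exists_eq_comp_history [Nonempty (Fin n)] {V : ℕ → (ℕ → Fin n) → ℝ}
    (hV : Nonanticipating V) (k : ℕ) :
    ∃ φ : (Finset.range k → Fin n) → ℝ, ∀ j : ℕ → Ω → Fin n, ∀ ω,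
      V k (fun m => j m ω) = φ (history j k ω) := by
  classical
  refine ⟨fun r => V k fun m => if h : m ∈ Finset.range k then r ⟨m, h⟩ else Classical.arbitrary _,
    fun j ω => hV k _ _ fun m hm => ?_⟩
  simp [history, hm]

variable [MeasurableSpace Ω]

lemma measurable_history {j : ℕ → Ω → Fin n} (hj : ∀ k, Measurable (j k)) (k : ℕ) :
    Measurable (history j k) :=
  measurable_pi_lambda _ fun m => hj m

/-- The filtration whose `k`-th σ-algebra is generated by the indices selected before time `k`. -/
def historyFiltration (j : ℕ → Ω → Fin n) (hj : ∀ k, Measurable (j k)) :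
    Filtration ℕ (inferInstance : MeasurableSpace Ω) where
  seq k := MeasurableSpace.comap (history j k) inferInstance
  mono' k l hkl := by
    have h : history j k = (fun (r : Finset.range l → Fin n) (m : Finset.range k) =>
        r ⟨m, Finset.range_mono hkl m.2⟩) ∘ history j l := rfl
    change MeasurableSpace.comap (history j k) _ ≤ _
    rw [h, ← MeasurableSpace.comap_comp]
    exact MeasurableSpace.comap_mono (measurable_of_countable _).comap_le
  le' k := (measurable_history hj k).comap_le

lemma integrable_comp_history {μ : Measure Ω} [IsFiniteMeasure μ] {j : ℕ → Ω → Fin n}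
    (hj : ∀ k, Measurable (j k)) {k : ℕ} (φ : (Finset.range k → Fin n) → ℝ) :
    Integrable (fun ω => φ (history j k ω)) μ := by
  obtain ⟨C, hC⟩ := (Set.finite_range fun r => ‖φ r‖).bddAbove
  exact Integrable.of_bound
    ((measurable_of_countable φ).comp (measurable_history hj k)).aestronglyMeasurable C
    (Eventually.of_forall fun ω => hC ⟨_, rfl⟩)

/-- Integrating over the index selected at time `k`, which is independent of the earlier ones. -/
lemma integral_eq_sum_update {μ : Measure Ω} [IsProbabilityMeasure μ] {p : Fin n → ℝ}
    {j : ℕ → Ω → Fin n} (hp : ∀ i, 0 ≤ p i) (hj : ∀ k, Measurable (j k)) (hindep : iIndepFun j μ)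
    (hlaw : ∀ k i, μ (j k ⁻¹' {i}) = ENNReal.ofReal (p i)) (k : ℕ)
    (φ : Fin n → (Finset.range k → Fin n) → ℝ) :
    ∫ ω, φ (j k ω) (history j k ω) ∂μ = ∫ ω, ∑ i, p i * φ i (history j k ω) ∂μ := by
  have hdec : ∀ ω, φ (j k ω) (history j k ω)
      = ∑ i, φ i (history j k ω) * (if j k ω = i then 1 else 0) := by
    intro ω; simp
  have hind : IndepFun (history j k) (j k) μ := by
    have h := hindep.indepFun_finset (Finset.range k) {k} (by simp) hj
    have hk : Measurable fun r : ({k} : Finset ℕ) → Fin n => r ⟨k, by simp⟩ :=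
      measurable_pi_apply _
    exact h.comp measurable_id hk
  have hprob : ∀ i, ∫ ω, (if j k ω = i then (1 : ℝ) else 0) ∂μ = p i := by
    intro i
    have : (fun ω => if j k ω = i then (1 : ℝ) else 0) = (j k ⁻¹' {i}).indicator 1 := by
      ext ω; simp [Set.indicator]
    rw [this, integral_indicator_one (hj k (measurableSet_singleton i)), measureReal_def, hlaw,
      ENNReal.toReal_ofReal (hp i)]
  have hm : ∀ i, Measurable fun l : Fin n => if l = i then (1 : ℝ) else 0 :=
    fun i => measurable_of_countable _
  have hint1 : ∀ i, Integrable (fun ω => if j k ω = i then (1 : ℝ) else 0) μ := fun i =>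
    Integrable.of_bound ((hm i).comp (hj k)).aestronglyMeasurable 1
      (Eventually.of_forall fun ω => by split_ifs <;> simp)
  have hind' : ∀ i, IndepFun (fun ω => φ i (history j k ω))
      (fun ω => if j k ω = i then (1 : ℝ) else 0) μ := fun i =>
    hind.comp (measurable_of_countable (φ i)) (hm i)
  have hint2 : ∀ i, Integrable
      (fun ω => φ i (history j k ω) * (if j k ω = i then (1 : ℝ) else 0)) μ := fun i =>
    (hind' i).integrable_mul (integrable_comp_history hj _) (hint1 i)
  simp_rw [hdec]
  rw [integral_finsetSum _ fun i _ => hint2 i,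
    integral_finsetSum _ fun i _ => (integrable_comp_history hj _).const_mul _]
  refine Finset.sum_congr rfl fun i _ => ?_
  rw [integral_const_mul, ← hprob i, mul_comm]
  exact (hind' i).integral_fun_mul_eq_mul_integral
    (integrable_comp_history hj _).aestronglyMeasurable (hint1 i).aestronglyMeasurable

lemma sum_eq_one {μ : Measure Ω} [IsProbabilityMeasure μ] {p : Fin n → ℝ}
    {j : ℕ → Ω → Fin n} (hp : ∀ i, 0 ≤ p i) (hj : ∀ k, Measurable (j k)) (hindep : iIndepFun j μ)
    (hlaw : ∀ k i, μ (j k ⁻¹' {i}) = ENNReal.ofReal (p i)) : ∑ i, p i = 1 := by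
  simpa using (integral_eq_sum_update hp hj hindep hlaw 0 fun _ _ => 1).symm

/-- A nonnegative functional that decreases on average at every step is a nonnegative
supermartingale, hence converges almost surely. -/
lemma ae_tendsto_of_average_le {μ : Measure Ω} [IsProbabilityMeasure μ] {p : Fin n → ℝ}
    {j : ℕ → Ω → Fin n} (hp : ∀ i, 0 ≤ p i) (hj : ∀ k, Measurable (j k)) (hindep : iIndepFun j μ)
    (hlaw : ∀ k i, μ (j k ⁻¹' {i}) = ENNReal.ofReal (p i))
    {V : ℕ → (ℕ → Fin n) → ℝ} (hV : Nonanticipating V) (hV0 : ∀ k a, 0 ≤ V k a)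
    (hdec : ∀ k a, ∑ i, p i * V (k + 1) (Function.update a k i) ≤ V k a) :
    ∀ᵐ ω ∂μ, ∃ c, Tendsto (fun k => V k fun m => j m ω) atTop (𝓝 c) := by
  classical
  have : Nonempty (Fin n) := ⟨j 0 (nonempty_of_isProbabilityMeasure μ).some⟩
  choose φ hφ using fun k => hV.exists_eq_comp_history (Ω := Ω) k
  have hint : ∀ k, Integrable (fun ω => V k fun m => j m ω) μ := fun k => by
    simp_rw [hφ k j]; exact integrable_comp_history hj _
  have hsup : Supermartingale (fun k ω => V k fun m => j m ω) (historyFiltration j hj) μ := by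
    refine supermartingale_of_setIntegral_succ_le (fun k => ?_) hint fun k s hs => ?_
    · simp_rw [hφ k j]
      exact ((measurable_of_countable (φ k)).comp
        (comap_measurable (history j k))).stronglyMeasurable
    · obtain ⟨t, -, rfl⟩ := hs
      have hs' : MeasurableSet (history j k ⁻¹' t) :=
        measurable_history hj k (Set.toFinite t).measurableSet
      -- the sequence with prescribed first `k + 1` terms, used to read off one step
      let ext : (Finset.range k → Fin n) → ℕ → Fin n := fun r m =>
        if h : m ∈ Finset.range k then r ⟨m, h⟩ else Classical.arbitrary _
      let ψ : Fin n → (Finset.range k → Fin n) → ℝ := fun i r =>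
        t.indicator (fun r => V (k + 1) (Function.update (ext r) k i)) r
      have hψ : ∀ i ω, ψ i (history j k ω) = (history j k ⁻¹' t).indicator
          (fun ω => V (k + 1) (Function.update (fun m => j m ω) k i)) ω := by
        intro i ω
        by_cases h : history j k ω ∈ t
        · simp only [ψ, Set.indicator_of_mem h, Set.indicator_of_mem (Set.mem_preimage.2 h)]
          refine hV _ _ _ fun m hm => ?_
          by_cases hmk : m = k
          · subst hmk; simp
          · have : m < k := by omega
            simp [hmk, ext, history, this]
        · simp [ψ, h]
      have h1 := integral_eq_sum_update hp hj hindep hlaw k ψ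
      rw [← integral_indicator hs', ← integral_indicator hs']
      have h2 : ∀ ω, ψ (j k ω) (history j k ω) = (history j k ⁻¹' t).indicator
          (fun ω => V (k + 1) fun m => j m ω) ω := by
        intro ω
        rw [hψ]
        by_cases h : ω ∈ history j k ⁻¹' t
        · simp only [Set.indicator_of_mem h]
          rw [Function.update_eq_self_iff.2 rfl]
        · simp [Set.indicator_of_notMem h]
      simp_rw [h2] at h1
      rw [h1]
      refine integral_mono
        (integrable_finsetSum _ fun i _ => (integrable_comp_history hj _).const_mul _)
        ((hint k).indicator hs') fun ω => ?_
      by_cases h : ω ∈ history j k ⁻¹' t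
      · simp only [hψ, Set.indicator_of_mem h]; exact hdec k _
      · simp [hψ, Set.indicator_of_notMem h]
  have hbdd : ∀ k, eLpNorm ((-fun k ω => V k fun m => j m ω) k) 1 μ
      ≤ (∫ ω, V 0 (fun m => j m ω) ∂μ).toNNReal := by
    intro k
    rw [Pi.neg_apply, eLpNorm_neg, eLpNorm_one_eq_lintegral_enorm,
      ← ofReal_integral_norm_eq_lintegral_enorm (hint k), ENNReal.ofReal]
    have : ∀ ω, ‖V k fun m => j m ω‖ = V k fun m => j m ω :=
      fun ω => Real.norm_of_nonneg (hV0 _ _)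
    simp_rw [this]
    refine ENNReal.coe_le_coe.2 (Real.toNNReal_le_toNNReal ?_)
    simpa using hsup.setIntegral_le (Nat.zero_le k) MeasurableSet.univ
  filter_upwards [hsup.neg.exists_ae_tendsto_of_bdd hbdd] with ω ⟨c, hc⟩
  exact ⟨-c, by simpa using hc.neg⟩

/-- The Robbins–Siegmund principle for functionals of the random indices: if `V` is nonnegative
and decreases on average by `R ≥ 0`, then almost surely `V` converges and `R` tends to zero. -/
lemma ae_tendsto_of_average_add_le {μ : Measure Ω} [IsProbabilityMeasure μ] {p : Fin n → ℝ}
    {j : ℕ → Ω → Fin n} (hp : ∀ i, 0 ≤ p i) (hj : ∀ k, Measurable (j k)) (hindep : iIndepFun j μ)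
    (hlaw : ∀ k i, μ (j k ⁻¹' {i}) = ENNReal.ofReal (p i))
    {V R : ℕ → (ℕ → Fin n) → ℝ} (hV : Nonanticipating V) (hR : Nonanticipating R)
    (hV0 : ∀ k a, 0 ≤ V k a) (hR0 : ∀ k a, 0 ≤ R k a)
    (hdec : ∀ k a, ∑ i, p i * V (k + 1) (Function.update a k i) + R k a ≤ V k a) :
    ∀ᵐ ω ∂μ, (∃ c, Tendsto (fun k => V k fun m => j m ω) atTop (𝓝 c)) ∧
      Tendsto (fun k => R k fun m => j m ω) atTop (𝓝 0) := by
  have hsum := sum_eq_one hp hj hindep hlaw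
  have h1 := ae_tendsto_of_average_le hp hj hindep hlaw hV hV0
    fun k a => (le_add_of_nonneg_right (hR0 k a)).trans (hdec k a)
  -- the accumulated decrease can be added to `V` without losing the supermartingale property
  have h2 := ae_tendsto_of_average_le hp hj hindep hlaw
    (V := fun k a => V k a + ∑ m ∈ Finset.range k, R m a)
    (fun k a b hab => by
      simp only
      rw [hV k a b hab]
      congr 1
      refine Finset.sum_congr rfl fun m hm => hR m a b fun l hl => hab l ?_
      exact hl.trans (Finset.mem_range.1 hm))
    (fun k a => add_nonneg (hV0 k a) (Finset.sum_nonneg fun m _ => hR0 m a))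
    (fun k a => by
      have : ∀ i, ∑ m ∈ Finset.range (k + 1), R m (Function.update a k i)
          = ∑ m ∈ Finset.range (k + 1), R m a := fun i =>
        Finset.sum_congr rfl fun m hm => hR m _ _ fun l hl => by
          have := Finset.mem_range.1 hm
          simp [show l ≠ k by omega]
      simp_rw [this, mul_add, Finset.sum_add_distrib, ← Finset.sum_mul, hsum, one_mul]
      rw [Finset.sum_range_succ]
      linarith [hdec k a])
  filter_upwards [h1, h2] with ω ⟨c, hc⟩ ⟨d, hd⟩
  refine ⟨⟨c, hc⟩, ?_⟩
  have hs : Tendsto (fun k => ∑ m ∈ Finset.range k, R m fun l => j l ω) atTop (𝓝 (d - c)) := by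
    simpa using hd.sub hc
  have := ((tendsto_add_atTop_iff_nat 1).2 hs).sub hs
  simpa [Finset.sum_range_succ] using this

end RandomIndices

/-! ### Subgradients and proximity operators -/

section ConvexAnalysis

variable {E : Type*}

lemma IsProper.eq_top_or_coe {h : E → EReal} (hp : IsProper h) (u : E) :
    h u = ⊤ ∨ ∃ c : ℝ, h u = c := by
  by_cases ht : h u = ⊤
  · exact Or.inl ht
  · exact Or.inr ⟨(h u).toReal, (EReal.coe_toReal ht (hp.1 u)).symm⟩

lemma IsProper.exists_coe {h : E → EReal} (hp : IsProper h) : ∃ u, ∃ c : ℝ, h u = c := by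
  obtain ⟨u, hu⟩ := hp.2
  exact ⟨u, (hp.eq_top_or_coe u).resolve_left hu⟩

lemma IsProper.exists_coe_of_le {h : E → EReal} (hp : IsProper h) {u : E} {d : ℝ}
    (hu : h u ≤ d) : ∃ c : ℝ, h u = c ∧ c ≤ d := by
  rcases hp.eq_top_or_coe u with ht | ⟨c, hc⟩
  · rw [ht] at hu; exact absurd (top_le_iff.1 hu) (EReal.coe_ne_top d)
  · exact ⟨c, hc, by rw [hc] at hu; exact_mod_cast hu⟩

variable [NormedAddCommGroup E] [InnerProductSpace ℝ E]

/-- The class `Γ₀(E)` of convex, proper and lower semicontinuous functionals. -/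
structure IsGammaZero (h : E → EReal) : Prop where
  convex : IsConvex h
  proper : IsProper h
  lsc : LowerSemicontinuous h

/-- `ξ` is a subgradient of `h` at `u`, a point where `h` is finite. The subgradient inequality is
asked only at the points where `h` is finite, which is enough when `h` avoids `-∞`. -/
def HasSubgradient (h : E → EReal) (u ξ : E) : Prop :=
  ∃ c : ℝ, h u = c ∧ ∀ u' (c' : ℝ), h u' = c' → c + inner ℝ ξ (u' - u) ≤ c'

/-- The graph of the subdifferential is monotone. -/
lemma HasSubgradient.inner_nonneg {h : E → EReal} {u ξ u' ξ' : E} (hu : HasSubgradient h u ξ)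
    (hu' : HasSubgradient h u' ξ') : 0 ≤ inner ℝ (ξ - ξ') (u - u') := by
  obtain ⟨c, hc, H⟩ := hu
  obtain ⟨c', hc', H'⟩ := hu'
  have h1 := H u' c' hc'
  have h2 := H' u c hc
  have h3 : inner ℝ ξ (u' - u) = - inner ℝ ξ (u - u') := by rw [← inner_neg_right, neg_sub]
  rw [inner_sub_left]
  linarith

/-- First-order condition for the minimization problem that defines the proximity operator. -/
lemma IsProx.hasSubgradient {h : E → EReal} (hc : IsConvex h) (hp : IsProper h) {σ : ℝ}
    (hσ : 0 < σ) {u v : E} (hu : IsProx σ h v u) : HasSubgradient h u (σ⁻¹ • (v - u)) := by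
  -- a minimizer has finite value, since the objective is finite somewhere
  have hfin : ∃ c : ℝ, h u = c := by
    refine (hp.eq_top_or_coe u).resolve_left fun ht => ?_
    obtain ⟨u₀, c₀, hc₀⟩ := hp.exists_coe
    have h1 := hu u₀
    rw [ht, EReal.coe_mul_top_of_pos hσ, EReal.coe_add_top, hc₀, top_le_iff] at h1
    exact EReal.coe_ne_top _ (by exact_mod_cast h1)
  obtain ⟨c, hcu⟩ := hfin
  refine ⟨c, hcu, fun u' c' hc' => ?_⟩
  -- compare `u` with the points of the segment from `u` to `u'`
  have key : ∀ t : ℝ, 0 < t → t < 1 →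
      inner ℝ (v - u) (u' - u) ≤ σ * (c' - c) + t * (‖u' - u‖ ^ 2 / 2) := by
    intro t ht0 ht1
    have h1 := hc u u' (1 - t) t (by linarith) ht0 (by ring)
    rw [hcu, hc'] at h1
    obtain ⟨d, hd, hdle⟩ := hp.exists_coe_of_le (d := (1 - t) * c + t * c') (by exact_mod_cast h1)
    have h2 := hu ((1 - t) • u + t • u')
    rw [hcu, hd] at h2
    have h3 : ‖v - u‖ ^ 2 / 2 + σ * c ≤ ‖v - ((1 - t) • u + t • u')‖ ^ 2 / 2 + σ * d := by
      exact_mod_cast h2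
    have h4 : v - ((1 - t) • u + t • u') = (v - u) - t • (u' - u) := by module
    rw [h4, norm_sub_sq_real (v - u), real_inner_smul_right, norm_smul, mul_pow, Real.norm_eq_abs,
      sq_abs] at h3
    have h5 : σ * d ≤ σ * ((1 - t) * c + t * c') := mul_le_mul_of_nonneg_left hdle hσ.le
    refine le_of_mul_le_mul_left ?_ ht0
    nlinarith
  have lim : Tendsto (fun t : ℝ => σ * (c' - c) + t * (‖u' - u‖ ^ 2 / 2)) (𝓝[>] 0)
      (𝓝 (σ * (c' - c))) := by
    have : Continuous fun t : ℝ => σ * (c' - c) + t * (‖u' - u‖ ^ 2 / 2) := by fun_prop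
    simpa using (this.tendsto 0).mono_left nhdsWithin_le_nhds
  have h6 : inner ℝ (v - u) (u' - u) ≤ σ * (c' - c) :=
    ge_of_tendsto lim (by
      filter_upwards [Ioo_mem_nhdsGT (zero_lt_one' ℝ)] with t ht using key t ht.1 ht.2)
  rw [real_inner_smul_left, inv_mul_eq_div]
  have : inner ℝ (v - u) (u' - u) / σ ≤ c' - c := by
    rw [div_le_iff₀ hσ]; linarith
  linarith

/-- In finite dimensions a functional of class `Γ₀` decreases at most linearly: it is bounded below
on a ball around a point where it is finite, and convexity propagates the bound. -/
lemma IsGammaZero.exists_linear_lower_bound [FiniteDimensional ℝ E] {h : E → EReal}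
    (hh : IsGammaZero h) : ∃ u₀, ∃ c₀ C : ℝ, h u₀ = c₀ ∧ 0 ≤ C ∧
      ∀ u (c : ℝ), h u = c → -(C * (1 + ‖u - u₀‖)) ≤ c := by
  have := FiniteDimensional.proper_real E
  obtain ⟨u₀, c₀, hc₀⟩ := hh.proper.exists_coe
  obtain ⟨u₁, -, hmin⟩ := (hh.lsc.lowerSemicontinuousOn _).exists_isMinOn
    (s := Metric.closedBall u₀ 1) ⟨u₀, by simp⟩ (isCompact_closedBall _ _)
  obtain ⟨m, hm, -⟩ := hh.proper.exists_coe_of_le (u := u₁) (d := c₀)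
    (hc₀ ▸ hmin (Metric.mem_closedBall_self zero_le_one))
  have hball : ∀ u (c : ℝ), ‖u - u₀‖ ≤ 1 → h u = c → m ≤ c := by
    intro u c hu hc
    have h1 : h u₁ ≤ h u := hmin (mem_closedBall_iff_norm.2 hu)
    rw [hm, hc] at h1
    exact_mod_cast h1
  refine ⟨u₀, c₀, |m| + |c₀|, hc₀, by positivity, fun u c hc => ?_⟩
  have hm' := neg_abs_le m
  have hc' := le_abs_self c₀
  rcases le_or_gt ‖u - u₀‖ 1 with hu | hu
  · have := hball u c hu hc
    nlinarith [norm_nonneg (u - u₀), abs_nonneg m, abs_nonneg c₀]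
  · set t := ‖u - u₀‖ with ht
    have ht0 : 0 < t := by linarith
    have h1 := hh.convex u₀ u (1 - t⁻¹) t⁻¹ (by
      have := inv_lt_one_of_one_lt₀ hu
      linarith) (inv_pos.2 ht0) (by ring)
    rw [hc₀, hc] at h1
    obtain ⟨d, hd, hdle⟩ := hh.proper.exists_coe_of_le (d := (1 - t⁻¹) * c₀ + t⁻¹ * c)
      (by exact_mod_cast h1)
    have h2 := hball _ d (by
      have : (1 - t⁻¹) • u₀ + t⁻¹ • u - u₀ = t⁻¹ • (u - u₀) := by module
      rw [this, norm_smul, norm_inv, norm_norm, inv_mul_cancel₀ ht0.ne']) hd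
    have h3 : t * m ≤ t * ((1 - t⁻¹) * c₀ + t⁻¹ * c) :=
      mul_le_mul_of_nonneg_left (h2.trans hdle) ht0.le
    have h4 : t * ((1 - t⁻¹) * c₀ + t⁻¹ * c) = (t - 1) * c₀ + c := by field_simp
    nlinarith [abs_nonneg m, abs_nonneg c₀]

lemma IsGammaZero.exists_isProx [FiniteDimensional ℝ E] {h : E → EReal} (hh : IsGammaZero h)
    {σ : ℝ} (hσ : 0 < σ) (v : E) : ∃ u, IsProx σ h v u := by
  have := FiniteDimensional.proper_real E
  obtain ⟨u₀, c₀, C, hc₀, hC, hlow⟩ := hh.exists_linear_lower_bound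
  have hlsc : LowerSemicontinuous
      fun u => ((‖v - u‖ ^ 2 / 2 : ℝ) : EReal) + (σ : EReal) * h u := by
    refine LowerSemicontinuous.add' ?_ ?_ fun u => ?_
    · exact (continuous_coe_real_ereal.comp (by fun_prop)).lowerSemicontinuous
    · have hmul : Continuous fun a : EReal => (σ : EReal) * a := continuous_iff_continuousAt.2
        fun a => EReal.Tendsto.const_mul tendsto_id (by simp) (by simp)
      exact hmul.comp_lowerSemicontinuous hh.lsc
        fun a b hab => mul_le_mul_of_nonneg_left hab (by exact_mod_cast hσ.le)
    · exact EReal.continuousAt_add (Or.inl (EReal.coe_ne_top _)) (Or.inl (EReal.coe_ne_bot _))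
  -- outside the ball of radius `r` the objective exceeds its value at `u₀`
  set d := ‖v - u₀‖ with hd
  set K := σ * C + |σ * c₀| with hK
  set r := 2 * (d + σ * C) + 2 * K + 1 with hr
  have hσC : 0 ≤ σ * C := by positivity
  have hK0 : 0 ≤ K := by positivity
  have hd0 : 0 ≤ d := norm_nonneg _
  obtain ⟨u, -, hmin⟩ := (hlsc.lowerSemicontinuousOn _).exists_isMinOn
    (s := Metric.closedBall u₀ r) ⟨u₀, by simp; linarith⟩ (isCompact_closedBall _ _)
  refine ⟨u, fun u' => ?_⟩
  by_cases hu' : ‖u' - u₀‖ ≤ r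
  · exact hmin (mem_closedBall_iff_norm.2 hu')
  refine (hmin (Metric.mem_closedBall_self (by linarith))).trans ?_
  rcases hh.proper.eq_top_or_coe u' with ht | ⟨c', hc'⟩
  · rw [ht, EReal.coe_mul_top_of_pos hσ, EReal.coe_add_top]; exact le_top
  · simp only [hc₀, hc']
    norm_cast
    push Not at hu'
    set s := ‖u' - u₀‖ with hs
    have h1 : s - d ≤ ‖v - u'‖ := by
      have := norm_sub_norm_le (u' - u₀) (v - u₀)
      rwa [sub_sub_sub_cancel_right, norm_sub_rev u' v] at this
    have h2 : (s - d) ^ 2 ≤ ‖v - u'‖ ^ 2 := pow_le_pow_left₀ (by linarith) h1 2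
    have h3 : σ * -(C * (1 + s)) ≤ σ * c' := mul_le_mul_of_nonneg_left (hlow u' c' hc') hσ.le
    have h4 := le_abs_self (σ * c₀)
    nlinarith [mul_nonneg (by linarith : (0 : ℝ) ≤ s - 1) hK0,
      mul_nonneg (by linarith : (0 : ℝ) ≤ s) (by linarith : (0 : ℝ) ≤ s - r)]

/-- The point `prox σ h v` is the resolvent of the subdifferential at `v`; existence of a minimizer
makes the choice in the definition of `prox` meaningful. -/
lemma IsGammaZero.hasSubgradient_prox [FiniteDimensional ℝ E] {h : E → EReal}
    (hh : IsGammaZero h) {σ : ℝ} (hσ : 0 < σ) (v : E) :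
    HasSubgradient h (prox σ h v) (σ⁻¹ • (v - prox σ h v)) :=
  (Classical.epsilon_spec (hh.exists_isProx hσ v)).hasSubgradient hh.convex hh.proper hσ

/-- The proximity operator is firmly nonexpansive. -/
lemma IsGammaZero.norm_prox_sub_sq_le [FiniteDimensional ℝ E] {h : E → EReal}
    (hh : IsGammaZero h) {σ : ℝ} (hσ : 0 < σ) (v w : E) :
    ‖prox σ h v - prox σ h w‖ ^ 2 ≤ inner ℝ (prox σ h v - prox σ h w) (v - w) := by
  have h1 := (hh.hasSubgradient_prox hσ v).inner_nonneg (hh.hasSubgradient_prox hσ w)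
  rw [← smul_sub, real_inner_smul_left] at h1
  have h2 := nonneg_of_mul_nonneg_right h1 (inv_pos.2 hσ)
  have h3 : v - prox σ h v - (w - prox σ h w) = (v - w) - (prox σ h v - prox σ h w) := by abel
  rw [h3, inner_sub_left, real_inner_self_eq_norm_sq, real_inner_comm] at h2
  linarith

lemma IsGammaZero.continuous_prox [FiniteDimensional ℝ E] {h : E → EReal} (hh : IsGammaZero h)
    {σ : ℝ} (hσ : 0 < σ) : Continuous (prox σ h) := by
  refine (LipschitzWith.of_dist_le_mul (K := 1) fun v w => ?_).continuous
  rw [dist_eq_norm, dist_eq_norm, NNReal.coe_one, one_mul]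
  have h1 := (hh.norm_prox_sub_sq_le hσ v w).trans (real_inner_le_norm _ _)
  rcases (norm_nonneg (prox σ h v - prox σ h w)).eq_or_lt with h0 | h0
  · rw [← h0]; exact norm_nonneg _
  · exact le_of_mul_le_mul_left (by linarith) h0

lemma IsGammaZero.prox_eq_iff [FiniteDimensional ℝ E] {h : E → EReal} (hh : IsGammaZero h)
    {σ : ℝ} (hσ : 0 < σ) {u ξ : E} : prox σ h (u + σ • ξ) = u ↔ HasSubgradient h u ξ := by
  have e : σ⁻¹ • (u + σ • ξ - u) = ξ := by
    rw [add_sub_cancel_left, smul_smul, inv_mul_cancel₀ hσ.ne', one_smul]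
  constructor
  · intro hu
    have h1 := hh.hasSubgradient_prox hσ (u + σ • ξ)
    rwa [hu, e] at h1
  · intro hu
    have h1 := (hh.hasSubgradient_prox hσ (u + σ • ξ)).inner_nonneg hu
    set w := prox σ h (u + σ • ξ)
    have h2 : σ⁻¹ • (u + σ • ξ - w) - ξ = -(σ⁻¹ • (w - u)) := by
      nth_rw 2 [← e]; module
    rw [h2, inner_neg_left, real_inner_smul_left, real_inner_self_eq_norm_sq] at h1
    have h3 : ‖w - u‖ ^ 2 ≤ 0 := by
      by_contra hcon
      push Not at hcon
      have := mul_pos (inv_pos.2 hσ) hcon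
      linarith
    have h4 : ‖w - u‖ = 0 := by nlinarith [norm_nonneg (w - u), sq_nonneg ‖w - u‖]
    exact sub_eq_zero.1 (norm_eq_zero.1 h4)

lemma IsProper.conj_le_iff {f : E → EReal} (hp : IsProper f) {y : E} {d : EReal} :
    conj f y ≤ d ↔ ∀ x (c : ℝ), f x = c → ((inner ℝ x y - c : ℝ) : EReal) ≤ d := by
  rw [conj, iSup_le_iff]
  refine forall_congr' fun x => ⟨fun h c hc => ?_, fun h => ?_⟩
  · rw [hc] at h; exact_mod_cast h
  · rcases hp.eq_top_or_coe x with ht | ⟨c, hc⟩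
    · rw [ht, EReal.sub_top]; exact bot_le
    · have := h c hc
      rw [hc]; exact_mod_cast this

/-- The convex conjugate of a functional of class `Γ₀` is of class `Γ₀`. It is finite at the
subgradients of `f`, which exist because `f` has a proximity operator. -/
lemma IsGammaZero.conj [FiniteDimensional ℝ E] {f : E → EReal} (hf : IsGammaZero f) :
    IsGammaZero (conj f) := by
  have hp := hf.proper
  have hle : ∀ x y (c : ℝ), f x = c → ((inner ℝ x y - c : ℝ) : EReal) ≤ SPDHG.conj f y :=
    fun x y => hp.conj_le_iff.1 le_rfl x
  have hbot : ∀ y, SPDHG.conj f y ≠ ⊥ := by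
    intro y hy
    obtain ⟨x, c, hc⟩ := hp.exists_coe
    have := hle x y c hc
    rw [hy, le_bot_iff] at this
    exact EReal.coe_ne_bot _ this
  refine ⟨fun y y' a b ha hb hab => ?_, ⟨hbot, ?_⟩, ?_⟩
  · refine hp.conj_le_iff.2 fun x c hc => ?_
    have h1 := hle x y c hc
    have h2 := hle x y' c hc
    have h3 : ((inner ℝ x (a • y + b • y') - c : ℝ) : EReal)
        = (a : EReal) * ((inner ℝ x y - c : ℝ) : EReal)
          + (b : EReal) * ((inner ℝ x y' - c : ℝ) : EReal) := by
      norm_cast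
      rw [inner_add_right, real_inner_smul_right, real_inner_smul_right]
      linear_combination c * hab
    rw [h3]
    exact add_le_add (mul_le_mul_of_nonneg_left h1 (by exact_mod_cast ha.le))
      (mul_le_mul_of_nonneg_left h2 (by exact_mod_cast hb.le))
  · obtain ⟨c, hc, H⟩ := hf.hasSubgradient_prox one_pos 0
    set u := prox 1 f 0
    set ξ := (1 : ℝ)⁻¹ • (0 - u)
    refine ⟨ξ, fun ht => ?_⟩
    have h1 : SPDHG.conj f ξ ≤ ((inner ℝ u ξ - c : ℝ) : EReal) := by
      refine hp.conj_le_iff.2 fun x c' hc' => ?_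
      have h2 := H x c' hc'
      rw [inner_sub_right, real_inner_comm x ξ, real_inner_comm u ξ] at h2
      norm_cast
      linarith
    rw [ht, top_le_iff] at h1
    exact EReal.coe_ne_top _ h1
  · refine lowerSemicontinuous_iSup fun x => Continuous.lowerSemicontinuous ?_
    rcases hp.eq_top_or_coe x with ht | ⟨c, hc⟩
    · simp only [ht, EReal.sub_top]; exact continuous_const
    · simp only [hc]
      have : ∀ y, ((inner ℝ x y : ℝ) : EReal) - (c : EReal) = ((inner ℝ x y - c : ℝ) : EReal) :=
        fun y => by norm_cast
      simp_rw [this]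
      exact continuous_coe_real_ereal.comp (by fun_prop)

end ConvexAnalysis

/-! ### Saddle points as fixed points -/

section Saddle

variable {n : ℕ} {X : Type*} {Y : Fin n → Type*}
  [NormedAddCommGroup X] [InnerProductSpace ℝ X]
  [∀ i, NormedAddCommGroup (Y i)] [∀ i, InnerProductSpace ℝ (Y i)]
  {A : ∀ i, X →L[ℝ] Y i} {f : ∀ i, Y i → EReal} {g : X → EReal}

lemma lagrangian_eq_of_coe {x : X} {y : ∀ i, Y i} {c : Fin n → ℝ}
    (hc : ∀ i, conj (f i) (y i) = c i) :
    lagrangian A f g x y = ((∑ i, (inner ℝ (A i x) (y i) - c i) : ℝ) : EReal) + g x := by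
  have : ∀ s : Finset (Fin n), ∑ i ∈ s, (((inner ℝ (A i x) (y i) : ℝ) : EReal) - conj (f i) (y i))
      = ((∑ i ∈ s, (inner ℝ (A i x) (y i) - c i) : ℝ) : EReal) := by
    intro s
    induction s using Finset.induction_on with
    | empty => simp
    | insert i s his ih => rw [Finset.sum_insert his, Finset.sum_insert his, ih, hc]; norm_cast
  rw [lagrangian, this]

lemma lagrangian_eq_bot {x : X} {y : ∀ i, Y i} {i : Fin n} (hi : conj (f i) (y i) = ⊤) :
    lagrangian A f g x y = ⊥ := by
  rw [lagrangian, ← Finset.add_sum_erase _ _ (Finset.mem_univ i), hi, EReal.sub_top,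
    EReal.bot_add, EReal.bot_add]

/-- Saddle points are the solutions of the first-order conditions `-Aᵀŷ ∈ ∂g(x̂)` and
`A_i x̂ ∈ ∂f_i^*(ŷ_i)`. In particular `g(x̂)` and `f_i^*(ŷ_i)` are finite. -/
lemma isSaddlePoint_iff [CompleteSpace X] [∀ i, CompleteSpace (Y i)]
    (hg : IsProper g) (hf : ∀ i, IsProper (conj (f i))) {w : X × (∀ i, Y i)} :
    IsSaddlePoint A f g w ↔
      HasSubgradient g w.1 (-∑ i, ContinuousLinearMap.adjoint (A i) (w.2 i)) ∧
        ∀ i, HasSubgradient (conj (f i)) (w.2 i) (A i w.1) := by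
  obtain ⟨x, y⟩ := w
  have hadj : ∀ x' : X, inner ℝ (-∑ i, ContinuousLinearMap.adjoint (A i) (y i)) (x' - x)
      = ∑ i, inner ℝ (A i x) (y i) - ∑ i, inner ℝ (A i x') (y i) := by
    intro x'
    rw [inner_neg_left, sum_inner, ← Finset.sum_neg_distrib, ← Finset.sum_sub_distrib]
    refine Finset.sum_congr rfl fun i _ => ?_
    rw [ContinuousLinearMap.adjoint_inner_left, map_sub, inner_sub_right, real_inner_comm,
      real_inner_comm (A i x)]
    ring
  constructor
  · rintro ⟨hy, hx⟩
    simp only at hy hx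
    -- if some `f_i^*(y_i)` were infinite, `y` would have value `-∞` and not be maximal
    have hfin : ∀ i, ∃ c : ℝ, conj (f i) (y i) = c := by
      by_contra hcon
      push Not at hcon
      obtain ⟨i, hi⟩ := hcon
      have htop := ((hf i).eq_top_or_coe (y i)).resolve_right fun ⟨c, hc⟩ => hi c hc
      choose y' c' hc' using fun i => (hf i).exists_coe
      have h1 := hy y'
      rw [lagrangian_eq_bot htop, lagrangian_eq_of_coe hc', le_bot_iff, EReal.add_eq_bot_iff] at h1
      exact h1.elim (EReal.coe_ne_bot _) (hg.1 x)
    choose c hc using hfin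
    have hgfin : ∃ d : ℝ, g x = d := by
      refine (hg.eq_top_or_coe x).resolve_left fun ht => ?_
      obtain ⟨x', d, hd⟩ := hg.exists_coe
      have h1 := hx x'
      rw [lagrangian_eq_of_coe hc, lagrangian_eq_of_coe hc, ht, hd, EReal.coe_add_top,
        top_le_iff] at h1
      exact EReal.coe_ne_top _ (by exact_mod_cast h1)
    obtain ⟨d, hd⟩ := hgfin
    refine ⟨⟨d, hd, fun x' d' hd' => ?_⟩, fun i => ⟨c i, hc i, fun u c' hc' => ?_⟩⟩
    · have h1 := hx x'
      rw [lagrangian_eq_of_coe hc, lagrangian_eq_of_coe hc, hd, hd'] at h1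
      norm_cast at h1
      rw [Finset.sum_sub_distrib, Finset.sum_sub_distrib] at h1
      change d + inner ℝ (-∑ i, ContinuousLinearMap.adjoint (A i) (y i)) (x' - x) ≤ d'
      rw [hadj]
      linarith
    · have h1 := hy (Function.update y i u)
      have hcu : ∀ l, conj (f l) (Function.update y i u l) = (Function.update c i c' l : ℝ) := by
        intro l
        by_cases hl : l = i
        · subst hl; simpa using hc'
        · simpa [hl] using hc l
      rw [lagrangian_eq_of_coe hc, lagrangian_eq_of_coe hcu, hd] at h1
      norm_cast at h1
      have h2 := le_of_add_le_add_right h1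
      rw [← Finset.add_sum_erase _ _ (Finset.mem_univ i),
        ← Finset.add_sum_erase (a := i) _ _ (Finset.mem_univ i),
        Finset.sum_congr rfl fun l hl => by
          rw [Function.update_of_ne (Finset.ne_of_mem_erase hl),
            Function.update_of_ne (Finset.ne_of_mem_erase hl)]] at h2
      simp only [Function.update_self] at h2
      simp only [inner_sub_right]
      linarith
  · rintro ⟨⟨d, hd, Hg⟩, hF⟩
    choose c hc Hf using hF
    simp only at hd Hg hc Hf
    refine ⟨fun y' => ?_, fun x' => ?_⟩
    · simp only
      by_cases hfin : ∀ i, ∃ c : ℝ, conj (f i) (y' i) = c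
      · choose c' hc' using hfin
        rw [lagrangian_eq_of_coe hc, lagrangian_eq_of_coe hc', hd]
        norm_cast
        refine add_le_add_left (Finset.sum_le_sum fun i _ => ?_) d
        have := Hf i (y' i) (c' i) (hc' i)
        rw [inner_sub_right] at this
        linarith
      · push Not at hfin
        obtain ⟨i, hi⟩ := hfin
        rw [lagrangian_eq_bot (((hf i).eq_top_or_coe (y' i)).resolve_right fun ⟨c, hc⟩ => hi c hc)]
        exact bot_le
    · simp only
      rw [lagrangian_eq_of_coe hc, lagrangian_eq_of_coe hc, hd]
      rcases hg.eq_top_or_coe x' with ht | ⟨d', hd'⟩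
      · rw [ht, EReal.coe_add_top]; exact le_top
      · have := Hg x' d' hd'
        rw [hadj] at this
        rw [hd']
        norm_cast
        rw [Finset.sum_sub_distrib, Finset.sum_sub_distrib]
        linarith

/-- Saddle points are the fixed points of one step of the proximal updates. -/
lemma isSaddlePoint_iff_prox [CompleteSpace X] [∀ i, CompleteSpace (Y i)]
    [FiniteDimensional ℝ X] [∀ i, FiniteDimensional ℝ (Y i)]
    (hg : IsGammaZero g) (hf : ∀ i, IsGammaZero (f i)) {τ : ℝ} (hτ : 0 < τ) {σ : Fin n → ℝ}
    (hσ : ∀ i, 0 < σ i) {w : X × (∀ i, Y i)} :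
    IsSaddlePoint A f g w ↔
      prox τ g (w.1 - τ • ∑ i, ContinuousLinearMap.adjoint (A i) (w.2 i)) = w.1 ∧
        ∀ i, prox (σ i) (conj (f i)) (w.2 i + σ i • A i w.1) = w.2 i := by
  rw [isSaddlePoint_iff hg.proper fun i => (hf i).conj.proper, ← hg.prox_eq_iff hτ, smul_neg,
    ← sub_eq_add_neg]
  exact and_congr_right' (forall_congr' fun i => ((hf i).conj.prox_eq_iff (hσ i)).symm)

end Saddle

/-! ### Convergence from cluster points -/

section Opial

/-- Opial's argument: a sequence converges if all its cluster points lie in `S` and if its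
discrepancy `D` to every point of a dense subset `C` of `S` converges. Only `C`, and not `S`, is
required to have the second property, so that `C` may be taken countable. -/
lemma exists_tendsto_of_cluster_mem {α : Type*} [PseudoMetricSpace α] [ProperSpace α]
    {D : α → α → ℝ} {K : ℝ} (hD : ∀ s w, dist s w ^ 2 ≤ K * D s w)
    (hDc : Continuous (Function.uncurry D)) (hD0 : ∀ w, D w w = 0) {S C : Set α}
    (hC : C.Nonempty) (hSC : S ⊆ closure C) {u : ℕ → α}
    (hu : ∀ w ∈ C, ∃ c, Tendsto (fun k => D (u k) w) atTop (𝓝 c))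
    (hcl : ∀ φ : ℕ → ℕ, StrictMono φ → ∀ w, Tendsto (u ∘ φ) atTop (𝓝 w) → w ∈ S) :
    ∃ w ∈ S, Tendsto u atTop (𝓝 w) := by
  obtain ⟨w₀, hw₀⟩ := hC
  obtain ⟨c₀, hc₀⟩ := hu w₀ hw₀
  obtain ⟨B, hB⟩ := (hc₀.const_mul K).bddAbove_range
  have hbdd : ∀ k, u k ∈ Metric.closedBall w₀ √B := fun k =>
    Real.le_sqrt_of_sq_le ((hD _ _).trans (hB ⟨k, rfl⟩))
  obtain ⟨w, -, φ, hφ, hw⟩ := tendsto_subseq_of_bounded Metric.isBounded_closedBall hbdd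
  have hwS := hcl φ hφ w hw
  refine ⟨w, hwS, Metric.tendsto_atTop'.2 fun ε hε => ?_⟩
  have hnear : ∀ᶠ v in 𝓝 w, K * D w v < (ε / 2) ^ 2 ∧ dist v w < ε / 2 := by
    refine Filter.Eventually.and ?_ (Metric.ball_mem_nhds w (half_pos hε))
    have : Continuous fun v => K * D w v :=
      continuous_const.mul (hDc.comp (by fun_prop : Continuous fun v => (w, v)))
    exact this.continuousAt.eventually_lt continuousAt_const (by rw [hD0, mul_zero]; positivity)
  obtain ⟨v, ⟨hv1, hv2⟩, hvC⟩ := mem_closure_iff_nhds.1 (hSC hwS) _ hnear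
  obtain ⟨c, hc⟩ := hu v hvC
  -- the limit of the whole sequence `D (u k) v` is identified along the subsequence
  have hcD : c = D w v := tendsto_nhds_unique (hc.comp hφ.tendsto_atTop)
    ((hDc.tendsto (w, v)).comp (hw.prodMk_nhds tendsto_const_nhds))
  have hlt := (hc.const_mul K).eventually_lt_const (hcD ▸ hv1)
  obtain ⟨N, hN⟩ := eventually_atTop.1 hlt
  refine ⟨N, fun k hk => ?_⟩
  have h1 : dist (u k) v < ε / 2 := lt_of_pow_lt_pow_left₀ 2 (by positivity)
    ((hD _ _).trans_lt (hN k hk.le))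
  linarith [dist_triangle (u k) v w]

end Opial

/-! ### The Lyapunov function -/

section Lyapunov

/-- As there are finitely many strict step size conditions, they hold with a common factor
`γ ^ 2 < 1` to spare. -/
lemma exists_stepSize_slack {ι : Type*} [Finite ι] {r p : ι → ℝ} (h : ∀ i, r i < p i) :
    ∃ γ : ℝ, 0 < γ ∧ γ < 1 ∧ ∀ i, r i ≤ γ ^ 2 * p i := by
  have h1 : ∀ i, ∀ᶠ γ : ℝ in 𝓝[<] 1, r i ≤ γ ^ 2 * p i := fun i => by
    have hc : Continuous fun γ : ℝ => γ ^ 2 * p i := by fun_prop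
    have := (hc.tendsto 1).mono_left (nhdsWithin_le_nhds (s := Set.Iio 1))
    exact (this.eventually_const_lt (by simpa using h i)).mono fun γ hγ => hγ.le
  obtain ⟨γ, hγ, h0, hlt⟩ := ((eventually_all.2 h1).and (Ioo_mem_nhdsLT zero_lt_one)).exists
  exact ⟨γ, h0, hlt, hγ⟩

variable {n : ℕ} {X : Type*} {Y : Fin n → Type*}
  [NormedAddCommGroup X] [∀ i, NormedAddCommGroup (Y i)]

/-- The squared distance `‖x - x̂‖² / (2τ) + ∑ i, ‖y_i - ŷ_i‖² / (2 p_i σ_i)` adapted to the step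
sizes and the selection probabilities. -/
noncomputable def weightedSqDist (τ : ℝ) (σ p : Fin n → ℝ) (u w : X × (∀ i, Y i)) : ℝ :=
  ‖u.1 - w.1‖ ^ 2 / (2 * τ) + ∑ i, ‖u.2 i - w.2 i‖ ^ 2 / (2 * p i * σ i)

lemma weightedSqDist_self (τ : ℝ) (σ p : Fin n → ℝ) (w : X × (∀ i, Y i)) :
    weightedSqDist τ σ p w w = 0 := by
  simp [weightedSqDist]

lemma continuous_weightedSqDist (τ : ℝ) (σ p : Fin n → ℝ) :
    Continuous (Function.uncurry (weightedSqDist (X := X) (Y := Y) τ σ p)) := by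
  unfold Function.uncurry weightedSqDist
  fun_prop

lemma dist_sq_le_weightedSqDist {τ : ℝ} {σ p : Fin n → ℝ} (hτ : 0 < τ) (hσ : ∀ i, 0 < σ i)
    (hp : ∀ i, 0 < p i) (u w : X × (∀ i, Y i)) :
    dist u w ^ 2 ≤ (2 * τ + ∑ i, 2 * p i * σ i) * weightedSqDist τ σ p u w := by
  have hpσ : ∀ i, 0 < 2 * p i * σ i := fun i => by have := hσ i; have := hp i; positivity
  have h0 : ∀ i, 0 ≤ ‖u.2 i - w.2 i‖ ^ 2 / (2 * p i * σ i) := fun i =>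
    div_nonneg (by positivity) (hpσ i).le
  have hsum0 : 0 ≤ ∑ i, ‖u.2 i - w.2 i‖ ^ 2 / (2 * p i * σ i) :=
    Finset.sum_nonneg fun i _ => h0 i
  have hsumK : 0 ≤ ∑ i, 2 * p i * σ i := Finset.sum_nonneg fun i _ => (hpσ i).le
  have hx0 : 0 ≤ ‖u.1 - w.1‖ ^ 2 / (2 * τ) := by positivity
  -- a term of `weightedSqDist` times its weight is a squared distance of components
  have key : ∀ {d W : ℝ}, 0 < W → W ≤ 2 * τ + ∑ i, 2 * p i * σ i →
      d ^ 2 / W ≤ weightedSqDist τ σ p u w →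
      d ^ 2 ≤ (2 * τ + ∑ i, 2 * p i * σ i) * weightedSqDist τ σ p u w := by
    intro d W hW hWK hd
    calc d ^ 2 = W * (d ^ 2 / W) := by field_simp
      _ ≤ _ := mul_le_mul hWK hd (by positivity) (hW.le.trans hWK)
  set M := (2 * τ + ∑ i, 2 * p i * σ i) * weightedSqDist τ σ p u w
  have hx : dist u.1 w.1 ^ 2 ≤ M := by
    rw [dist_eq_norm]
    refine key (W := 2 * τ) (by positivity) (by linarith) ?_
    exact le_add_of_nonneg_right hsum0
  have hy : ∀ i, dist (u.2 i) (w.2 i) ^ 2 ≤ M := by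
    intro i
    rw [dist_eq_norm]
    refine key (hpσ i) ?_ ?_
    · have := Finset.single_le_sum (fun l _ => (hpσ l).le) (Finset.mem_univ i)
      linarith
    · exact (Finset.single_le_sum (fun l _ => h0 l) (Finset.mem_univ i)).trans
        (le_add_of_nonneg_left hx0)
  have h : dist u w ≤ √M := by
    rw [Prod.dist_eq]
    exact max_le (Real.le_sqrt_of_sq_le hx)
      ((dist_pi_le_iff (Real.sqrt_nonneg _)).2 fun i => Real.le_sqrt_of_sq_le (hy i))
  calc dist u w ^ 2 ≤ √M ^ 2 := pow_le_pow_left₀ dist_nonneg h 2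
    _ = M := Real.sq_sqrt ((sq_nonneg _).trans hx)

variable [InnerProductSpace ℝ X]

/-- The Lyapunov function with respect to the reference point `w`. The extrapolation error
`z̄ - z` enters through the cross term with the primal error, and through a square that makes the
sum nonnegative for `0 < γ < 1`. -/
noncomputable def lyapunov (τ : ℝ) (σ p : Fin n → ℝ) (γ : ℝ) (w : X × (∀ i, Y i))
    (s : State X Y) : ℝ :=
  weightedSqDist τ σ p (s.x, s.y) w - inner ℝ (s.x - w.1) (s.zbar - s.z)
    + τ / (2 * γ) * ‖s.zbar - s.z‖ ^ 2

lemma abs_inner_le_young {E : Type*} [NormedAddCommGroup E] [InnerProductSpace ℝ E] {τ γ : ℝ}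
    (hτ : 0 < τ) (hγ : 0 < γ) (a b : E) :
    |inner ℝ a b| ≤ γ * (‖a‖ ^ 2 / (2 * τ)) + τ / (2 * γ) * ‖b‖ ^ 2 := by
  refine (abs_real_inner_le_norm a b).trans ?_
  have h1 : γ * (‖a‖ ^ 2 / (2 * τ)) + τ / (2 * γ) * ‖b‖ ^ 2 - ‖a‖ * ‖b‖
      = (γ * ‖a‖ - τ * ‖b‖) ^ 2 / (2 * γ * τ) := by
    field_simp; ring
  have h2 : 0 ≤ (γ * ‖a‖ - τ * ‖b‖) ^ 2 / (2 * γ * τ) := by positivity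
  linarith

lemma le_lyapunov {τ : ℝ} {σ p : Fin n → ℝ} {γ : ℝ} (hτ : 0 < τ) (hσ : ∀ i, 0 < σ i)
    (hp : ∀ i, 0 < p i) (hγ : 0 < γ) (w : X × (∀ i, Y i)) (s : State X Y) :
    (1 - γ) * (‖s.x - w.1‖ ^ 2 / (2 * τ)) ≤ lyapunov τ σ p γ w s := by
  have h1 := (le_abs_self _).trans (abs_inner_le_young hτ hγ (s.x - w.1) (s.zbar - s.z))
  have h2 : 0 ≤ ∑ i, ‖s.y i - w.2 i‖ ^ 2 / (2 * p i * σ i) := Finset.sum_nonneg fun i _ => by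
    have := hσ i; have := hp i; positivity
  unfold lyapunov weightedSqDist
  linarith

/-- Once the extrapolation error vanishes, the Lyapunov function has the same limit as the
weighted squared distance. -/
lemma exists_tendsto_weightedSqDist {τ : ℝ} {σ p : Fin n → ℝ} {γ : ℝ} (hτ : 0 < τ)
    (hσ : ∀ i, 0 < σ i) (hp : ∀ i, 0 < p i) (hγ0 : 0 < γ) (hγ : γ < 1) {s : ℕ → State X Y}
    (he : Tendsto (fun k => (s k).zbar - (s k).z) atTop (𝓝 0)) {w : X × (∀ i, Y i)}
    (hV : ∃ c, Tendsto (fun k => lyapunov τ σ p γ w (s k)) atTop (𝓝 c)) :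
    ∃ c, Tendsto (fun k => weightedSqDist τ σ p ((s k).x, (s k).y) w) atTop (𝓝 c) := by
  obtain ⟨c, hc⟩ := hV
  obtain ⟨B, hB⟩ := hc.bddAbove_range
  have hγ' : 0 < 1 - γ := by linarith
  have hxB : ∀ k, ‖(s k).x - w.1‖ ≤ √(2 * τ / (1 - γ) * B) := fun k => by
    refine Real.le_sqrt_of_sq_le ?_
    have h1 := (le_lyapunov hτ hσ hp hγ0 w (s k)).trans (hB ⟨k, rfl⟩)
    have h2 : ‖(s k).x - w.1‖ ^ 2
        = 2 * τ / (1 - γ) * ((1 - γ) * (‖(s k).x - w.1‖ ^ 2 / (2 * τ))) := by field_simp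
    rw [h2]
    gcongr
  have he' := he.norm
  rw [norm_zero] at he'
  have hin : Tendsto (fun k => inner ℝ ((s k).x - w.1) ((s k).zbar - (s k).z)) atTop (𝓝 0) := by
    refine squeeze_zero_norm (fun k => (norm_inner_le_norm _ _).trans
      (mul_le_mul_of_nonneg_right (hxB k) (norm_nonneg _))) ?_
    simpa using he'.const_mul √(2 * τ / (1 - γ) * B)
  refine ⟨c + 0 - τ / (2 * γ) * 0 ^ 2, ((hc.add hin).sub ((he'.pow 2).const_mul _)).congr
    fun k => ?_⟩
  unfold lyapunov
  ring

variable [∀ i, InnerProductSpace ℝ (Y i)]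

/-- The primal update, which does not depend on the selected index. -/
noncomputable def primalUpdate (g : X → EReal) (τ : ℝ) (s : State X Y) : X :=
  prox τ g (s.x - τ • s.zbar)

/-- The value that the `i`-th dual variable takes if the index `i` is selected. -/
noncomputable def dualUpdate (A : ∀ i, X →L[ℝ] Y i) (f : ∀ i, Y i → EReal) (g : X → EReal)
    (τ : ℝ) (σ : Fin n → ℝ) (s : State X Y) (i : Fin n) : Y i :=
  prox (σ i) (conj (f i)) (s.y i + σ i • A i (primalUpdate g τ s))

/-- The amount by which the Lyapunov function decreases on average in one step. -/
noncomputable def decrease (A : ∀ i, X →L[ℝ] Y i) (f : ∀ i, Y i → EReal) (g : X → EReal)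
    (τ : ℝ) (σ : Fin n → ℝ) (γ : ℝ) (s : State X Y) : ℝ :=
  (1 - γ) / 2 * (‖primalUpdate g τ s - s.x‖ ^ 2 / τ
    + ∑ i, ‖dualUpdate A f g τ σ s i - s.y i‖ ^ 2 / σ i)

lemma decrease_nonneg {A : ∀ i, X →L[ℝ] Y i} {f : ∀ i, Y i → EReal} {g : X → EReal}
    {τ : ℝ} {σ : Fin n → ℝ} {γ : ℝ} (hτ : 0 < τ) (hσ : ∀ i, 0 < σ i) (hγ : γ < 1)
    (s : State X Y) : 0 ≤ decrease A f g τ σ γ s := by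
  have : 0 ≤ ∑ i, ‖dualUpdate A f g τ σ s i - s.y i‖ ^ 2 / σ i :=
    Finset.sum_nonneg fun i _ => by have := hσ i; positivity
  have : 0 ≤ 1 - γ := by linarith
  unfold decrease
  positivity

lemma norm_primalUpdate_sub_sq_le {A : ∀ i, X →L[ℝ] Y i} {f : ∀ i, Y i → EReal} {g : X → EReal}
    {τ : ℝ} {σ : Fin n → ℝ} {γ : ℝ} (hτ : 0 < τ) (hσ : ∀ i, 0 < σ i) (hγ : γ < 1)
    (s : State X Y) :
    ‖primalUpdate g τ s - s.x‖ ^ 2 ≤ 2 * τ / (1 - γ) * decrease A f g τ σ γ s := by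
  have h : 0 ≤ ∑ i, ‖dualUpdate A f g τ σ s i - s.y i‖ ^ 2 / σ i :=
    Finset.sum_nonneg fun i _ => by have := hσ i; positivity
  have hγ' : 0 < 1 - γ := by linarith
  unfold decrease
  calc ‖primalUpdate g τ s - s.x‖ ^ 2 = 2 * τ / (1 - γ) * ((1 - γ) / 2 *
        (‖primalUpdate g τ s - s.x‖ ^ 2 / τ)) := by field_simp
    _ ≤ _ := by gcongr; exact le_add_of_nonneg_right h

lemma norm_dualUpdate_sub_sq_le {A : ∀ i, X →L[ℝ] Y i} {f : ∀ i, Y i → EReal} {g : X → EReal}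
    {τ : ℝ} {σ : Fin n → ℝ} {γ : ℝ} (hτ : 0 < τ) (hσ : ∀ i, 0 < σ i) (hγ : γ < 1)
    (s : State X Y) (i : Fin n) :
    ‖dualUpdate A f g τ σ s i - s.y i‖ ^ 2 ≤ 2 * σ i / (1 - γ) * decrease A f g τ σ γ s := by
  have hσi := hσ i
  have hγ' : 0 < 1 - γ := by linarith
  have h : ‖dualUpdate A f g τ σ s i - s.y i‖ ^ 2 / σ i
      ≤ ∑ i, ‖dualUpdate A f g τ σ s i - s.y i‖ ^ 2 / σ i :=
    Finset.single_le_sum (f := fun i => ‖dualUpdate A f g τ σ s i - s.y i‖ ^ 2 / σ i)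
      (fun l _ => by have := hσ l; positivity) (Finset.mem_univ i)
  unfold decrease
  calc ‖dualUpdate A f g τ σ s i - s.y i‖ ^ 2 = 2 * σ i / (1 - γ) * ((1 - γ) / 2 *
        (‖dualUpdate A f g τ σ s i - s.y i‖ ^ 2 / σ i)) := by field_simp
    _ ≤ _ := by gcongr; exact h.trans (le_add_of_nonneg_left (by positivity))

lemma tendsto_zero_of_norm_sq_le {E : Type*} [NormedAddCommGroup E] {u : ℕ → E} {r : ℕ → ℝ}
    (h : ∀ k, ‖u k‖ ^ 2 ≤ r k) (hr : Tendsto r atTop (𝓝 0)) : Tendsto u atTop (𝓝 0) :=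
  squeeze_zero_norm (fun k => Real.le_sqrt_of_sq_le (h k)) (by simpa using hr.sqrt)

/-- The three-point inequality for a firmly nonexpansive step. -/
lemma norm_sq_le_of_firm {E : Type*} [NormedAddCommGroup E] [InnerProductSpace ℝ E]
    {v y w b : E} (h : ‖v - w‖ ^ 2 ≤ inner ℝ (v - w) (y - w + b)) :
    ‖v - w‖ ^ 2 + ‖v - y‖ ^ 2 ≤ ‖y - w‖ ^ 2 + 2 * inner ℝ (v - w) b := by
  have h1 : v - y = (v - w) - (y - w) := by abel
  rw [h1, norm_sub_sq_real (v - w)]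
  rw [inner_add_right] at h
  linarith

variable [CompleteSpace X] [∀ i, CompleteSpace (Y i)]
  {A : ∀ i, X →L[ℝ] Y i} {f : ∀ i, Y i → EReal} {g : X → EReal}
  {τ : ℝ} {σ p : Fin n → ℝ} {γ : ℝ}

lemma step_x (i : Fin n) (s : State X Y) :
    (step A f g τ σ p i s).x = primalUpdate g τ s := rfl

lemma step_y (i : Fin n) (s : State X Y) :
    (step A f g τ σ p i s).y = Function.update s.y i (dualUpdate A f g τ σ s i) := rfl

lemma step_z (i : Fin n) (s : State X Y) : (step A f g τ σ p i s).z =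
    s.z + ContinuousLinearMap.adjoint (A i) (dualUpdate A f g τ σ s i - s.y i) := by
  simp [step, dualUpdate, primalUpdate]

lemma step_zbar_sub_z (i : Fin n) (s : State X Y) :
    (step A f g τ σ p i s).zbar - (step A f g τ σ p i s).z =
      (p i)⁻¹ • ContinuousLinearMap.adjoint (A i) (dualUpdate A f g τ σ s i - s.y i) := by
  simp [step, dualUpdate, primalUpdate]

/-- The contribution of the index `i` to the average of the Lyapunov function after one step. -/
lemma mul_lyapunov_step_le [∀ i, FiniteDimensional ℝ (Y i)] (hf : ∀ i, IsGammaZero (f i))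
    (hτ : 0 < τ) (hσ : ∀ i, 0 < σ i) (hp : ∀ i, 0 < p i) (hγ : 0 < γ)
    (hstep : ∀ i, τ * σ i * ‖A i‖ ^ 2 ≤ γ ^ 2 * p i) {w : X × (∀ i, Y i)}
    (hw : ∀ i, prox (σ i) (conj (f i)) (w.2 i + σ i • A i w.1) = w.2 i)
    (s : State X Y) (i : Fin n) :
    p i * lyapunov τ σ p γ w (step A f g τ σ p i s) ≤
      p i * weightedSqDist τ σ p (primalUpdate g τ s, s.y) w
        + inner ℝ (primalUpdate g τ s - w.1) (ContinuousLinearMap.adjoint (A i) (s.y i - w.2 i))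
        - (1 - γ) / 2 * (‖dualUpdate A f g τ σ s i - s.y i‖ ^ 2 / σ i) := by
  have hpi := hp i
  have hσi := hσ i
  set x' := primalUpdate g τ s with hx'
  set v := dualUpdate A f g τ σ s i with hv
  -- firm nonexpansiveness, for the dual update and the fixed point `w.2 i`
  have hfirm : ‖v - w.2 i‖ ^ 2 + ‖v - s.y i‖ ^ 2
      ≤ ‖s.y i - w.2 i‖ ^ 2 + 2 * inner ℝ (v - w.2 i) (σ i • A i (x' - w.1)) := by
    refine norm_sq_le_of_firm ?_
    have h := (hf i).conj.norm_prox_sub_sq_le hσi (s.y i + σ i • A i x') (w.2 i + σ i • A i w.1)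
    rw [hw i] at h
    have e : s.y i + σ i • A i x' - (w.2 i + σ i • A i w.1)
        = s.y i - w.2 i + σ i • A i (x' - w.1) := by rw [map_sub]; module
    rwa [e] at h
  have hdist : weightedSqDist τ σ p (x', Function.update s.y i v) w
      = weightedSqDist τ σ p (x', s.y) w
        + (‖v - w.2 i‖ ^ 2 - ‖s.y i - w.2 i‖ ^ 2) / (2 * p i * σ i) := by
    have h1 : ∀ l ∈ Finset.univ.erase i, ‖Function.update s.y i v l - w.2 l‖ ^ 2 / (2 * p l * σ l)
        = ‖s.y l - w.2 l‖ ^ 2 / (2 * p l * σ l) := fun l hl => by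
      rw [Function.update_of_ne (Finset.ne_of_mem_erase hl)]
    simp only [weightedSqDist]
    rw [← Finset.add_sum_erase _ _ (Finset.mem_univ i), Finset.sum_congr rfl h1,
      ← Finset.add_sum_erase _ (fun l => ‖s.y l - w.2 l‖ ^ 2 / _) (Finset.mem_univ i),
      Function.update_self]
    ring
  have hinner : ∀ d : Y i, inner ℝ (x' - w.1) (ContinuousLinearMap.adjoint (A i) d)
      = inner ℝ (A i (x' - w.1)) d := fun d => ContinuousLinearMap.adjoint_inner_right _ _ _
  -- the square of the new extrapolation error is controlled by the step size condition
  have hsq : τ / (2 * γ) * ‖(p i)⁻¹ • ContinuousLinearMap.adjoint (A i) (v - s.y i)‖ ^ 2 * p i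
      ≤ γ / 2 * (‖v - s.y i‖ ^ 2 / σ i) := by
    have h1 : ‖ContinuousLinearMap.adjoint (A i) (v - s.y i)‖ ^ 2
        ≤ ‖A i‖ ^ 2 * ‖v - s.y i‖ ^ 2 := by
      rw [← mul_pow]
      refine pow_le_pow_left₀ (norm_nonneg _) ?_ 2
      have := (ContinuousLinearMap.adjoint (A i)).le_opNorm (v - s.y i)
      rwa [LinearIsometryEquiv.norm_map] at this
    have h2 : τ * σ i * ‖ContinuousLinearMap.adjoint (A i) (v - s.y i)‖ ^ 2
        ≤ γ ^ 2 * p i * ‖v - s.y i‖ ^ 2 :=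
      calc _ ≤ τ * σ i * (‖A i‖ ^ 2 * ‖v - s.y i‖ ^ 2) := by gcongr
        _ = τ * σ i * ‖A i‖ ^ 2 * ‖v - s.y i‖ ^ 2 := by ring
        _ ≤ _ := mul_le_mul_of_nonneg_right (hstep i) (sq_nonneg _)
    rw [norm_smul, mul_pow, norm_inv, Real.norm_of_nonneg hpi.le]
    set q := ‖ContinuousLinearMap.adjoint (A i) (v - s.y i)‖ ^ 2
    set r := ‖v - s.y i‖ ^ 2
    calc τ / (2 * γ) * ((p i)⁻¹ ^ 2 * q) * p i = (τ * σ i * q) / (2 * γ * p i * σ i) := by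
          field_simp
      _ ≤ (γ ^ 2 * p i * r) / (2 * γ * p i * σ i) := by gcongr
      _ = γ / 2 * (r / σ i) := by field_simp
  unfold lyapunov
  rw [step_zbar_sub_z, step_x, step_y, hdist, real_inner_smul_right, hinner, hinner]
  rw [real_inner_smul_right, real_inner_comm] at hfirm
  have e1 : inner ℝ (A i (x' - w.1)) (s.y i - w.2 i)
      = inner ℝ (A i (x' - w.1)) (v - w.2 i) - inner ℝ (A i (x' - w.1)) (v - s.y i) := by
    rw [← inner_sub_right]; congr 1; abel
  have e2 : (‖v - w.2 i‖ ^ 2 - ‖s.y i - w.2 i‖ ^ 2) / (2 * σ i) + ‖v - s.y i‖ ^ 2 / (2 * σ i)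
      ≤ inner ℝ (A i (x' - w.1)) (v - w.2 i) := by
    rw [← add_div, div_le_iff₀ (by positivity)]
    linarith
  rw [e1]
  have e3 : p i * ((‖v - w.2 i‖ ^ 2 - ‖s.y i - w.2 i‖ ^ 2) / (2 * p i * σ i))
      = (‖v - w.2 i‖ ^ 2 - ‖s.y i - w.2 i‖ ^ 2) / (2 * σ i) := by field_simp
  have e4 : p i * ((p i)⁻¹ * inner ℝ (A i (x' - w.1)) (v - s.y i))
      = inner ℝ (A i (x' - w.1)) (v - s.y i) := by field_simp
  have e5 : (1 - γ) / 2 * (‖v - s.y i‖ ^ 2 / σ i)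
      = ‖v - s.y i‖ ^ 2 / (2 * σ i) - γ / 2 * (‖v - s.y i‖ ^ 2 / σ i) := by field_simp
  rw [e5]
  linarith

/-- On average the Lyapunov function decreases in every step. Dividing
by `p_i` compensates that `y_i` is only updated with probability `p_i`: the new extrapolation error
averages to the image under `Aᵀ` of the full dual update step, which cancels the coupling terms. -/
lemma sum_lyapunov_step_le [FiniteDimensional ℝ X] [∀ i, FiniteDimensional ℝ (Y i)]
    (hg : IsGammaZero g) (hf : ∀ i, IsGammaZero (f i))
    (hτ : 0 < τ) (hσ : ∀ i, 0 < σ i) (hp : ∀ i, 0 < p i) (hp1 : ∑ i, p i = 1) (hγ : 0 < γ)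
    (hstep : ∀ i, τ * σ i * ‖A i‖ ^ 2 ≤ γ ^ 2 * p i) {w : X × (∀ i, Y i)}
    (hw : IsSaddlePoint A f g w) (s : State X Y)
    (hz : s.z = ∑ i, ContinuousLinearMap.adjoint (A i) (s.y i)) :
    ∑ i, p i * lyapunov τ σ p γ w (step A f g τ σ p i s) + decrease A f g τ σ γ s
      ≤ lyapunov τ σ p γ w s := by
  obtain ⟨hwx, hwy⟩ := (isSaddlePoint_iff_prox hg hf hτ hσ).1 hw
  have hsum := Finset.sum_le_sum fun i (_ : i ∈ Finset.univ) =>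
    mul_lyapunov_step_le (g := g) hf hτ hσ hp hγ hstep hwy s i
  rw [Finset.sum_sub_distrib, Finset.sum_add_distrib, ← Finset.sum_mul, hp1, one_mul,
    ← inner_sum, ← Finset.mul_sum] at hsum
  simp only [map_sub, Finset.sum_sub_distrib] at hsum
  rw [← hz] at hsum
  set zs := ∑ i, ContinuousLinearMap.adjoint (A i) (w.2 i)
  set x' := primalUpdate g τ s with hx'
  -- firm nonexpansiveness, for the primal update and the fixed point `w.1`
  have hfirm : ‖x' - w.1‖ ^ 2 + ‖x' - s.x‖ ^ 2
      ≤ ‖s.x - w.1‖ ^ 2 + 2 * inner ℝ (x' - w.1) (-(τ • (s.zbar - zs))) := by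
    refine norm_sq_le_of_firm ?_
    have h := hg.norm_prox_sub_sq_le hτ (s.x - τ • s.zbar) (w.1 - τ • zs)
    rw [hwx] at h
    have e : s.x - τ • s.zbar - (w.1 - τ • zs) = s.x - w.1 + -(τ • (s.zbar - zs)) := by module
    rwa [e] at h
  rw [inner_neg_right, real_inner_smul_right] at hfirm
  have h1 : ‖x' - w.1‖ ^ 2 / (2 * τ) + ‖x' - s.x‖ ^ 2 / (2 * τ)
      ≤ ‖s.x - w.1‖ ^ 2 / (2 * τ) - inner ℝ (x' - w.1) (s.zbar - zs) := by
    rw [← add_div, div_le_iff₀ (by positivity), sub_mul, div_mul_cancel₀ _ (by positivity)]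
    linarith
  have h2 := (neg_abs_le _).trans' (neg_le_neg (abs_inner_le_young hτ hγ (x' - s.x) (s.zbar - s.z)))
  -- what is left of the coupling terms involves only the old extrapolation error
  have h3 : inner ℝ (x' - w.1) (s.z - zs) - inner ℝ (x' - w.1) (s.zbar - zs)
      = - inner ℝ (x' - s.x) (s.zbar - s.z) - inner ℝ (s.x - w.1) (s.zbar - s.z) := by
    simp only [inner_sub_left, inner_sub_right]; ring
  have h4 : (1 - γ) / 2 * (‖x' - s.x‖ ^ 2 / τ)
      = ‖x' - s.x‖ ^ 2 / (2 * τ) - γ * (‖x' - s.x‖ ^ 2 / (2 * τ)) := by field_simp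
  unfold decrease
  rw [← hx', mul_add, h4]
  unfold lyapunov weightedSqDist at *
  simp only at *
  linarith

end Lyapunov

/-! ### Limits of the iterates -/

section Iterates

variable {n : ℕ} {X : Type*} {Y : Fin n → Type*}
  [NormedAddCommGroup X] [InnerProductSpace ℝ X] [CompleteSpace X]
  [∀ i, NormedAddCommGroup (Y i)] [∀ i, InnerProductSpace ℝ (Y i)] [∀ i, CompleteSpace (Y i)]
  {A : ∀ i, X →L[ℝ] Y i} {f : ∀ i, Y i → EReal} {g : X → EReal}
  {τ : ℝ} {σ p : Fin n → ℝ} {γ : ℝ} {x₀ : X}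

lemma iterate_congr {a b : ℕ → Fin n} : ∀ {k : ℕ}, (∀ m < k, a m = b m) →
    iterate A f g τ σ p x₀ a k = iterate A f g τ σ p x₀ b k
  | 0, _ => rfl
  | k + 1, h => by
    rw [iterate, iterate, h k (Nat.lt_succ_self k),
      iterate_congr fun m hm => h m (hm.trans (Nat.lt_succ_self k))]

lemma iterate_update_succ (a : ℕ → Fin n) (k : ℕ) (i : Fin n) :
    iterate A f g τ σ p x₀ (Function.update a k i) (k + 1)
      = step A f g τ σ p i (iterate A f g τ σ p x₀ a k) := by
  rw [iterate, Function.update_self, iterate_congr fun m hm => Function.update_of_ne hm.ne _ _]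

/-- Along the iteration `z^k = Aᵀ y^k`. This is where `y⁰ = 0` and `z⁰ = 0` are used. -/
lemma iterate_z (a : ℕ → Fin n) (k : ℕ) :
    (iterate A f g τ σ p x₀ a k).z
      = ∑ i, ContinuousLinearMap.adjoint (A i) ((iterate A f g τ σ p x₀ a k).y i) := by
  induction k with
  | zero => simp [iterate]
  | succ k ih =>
    rw [iterate, step_z, step_y, ih]
    set s := iterate A f g τ σ p x₀ a k
    have h : ∀ l ∈ Finset.univ.erase (a k), ContinuousLinearMap.adjoint (A l)
          (Function.update s.y (a k) (dualUpdate A f g τ σ s (a k)) l)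
        = ContinuousLinearMap.adjoint (A l) (s.y l) := fun l hl => by
      rw [Function.update_of_ne (Finset.ne_of_mem_erase hl)]
    rw [← Finset.add_sum_erase _ _ (Finset.mem_univ (a k)),
      ← Finset.add_sum_erase _ (fun l => ContinuousLinearMap.adjoint (A l)
        (Function.update s.y (a k) (dualUpdate A f g τ σ s (a k)) l)) (Finset.mem_univ (a k)),
      Finset.sum_congr rfl h, Function.update_self, map_sub]
    abel

variable {a : ℕ → Fin n}

/-- If the decrease of the Lyapunov function vanishes along the iterates, so does the
extrapolation error. -/
lemma tendsto_zbar_sub_z (hσ : ∀ i, 0 < σ i) (hτ : 0 < τ) (hγ : γ < 1)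
    (hdec : Tendsto (fun k => decrease A f g τ σ γ (iterate A f g τ σ p x₀ a k)) atTop (𝓝 0)) :
    Tendsto (fun k => (iterate A f g τ σ p x₀ a k).zbar - (iterate A f g τ σ p x₀ a k).z)
      atTop (𝓝 0) := by
  rw [← tendsto_add_atTop_iff_nat 1]
  set s := iterate A f g τ σ p x₀ a with hs
  have hi : ∀ i, Tendsto (fun k => ‖(p i)⁻¹ • ContinuousLinearMap.adjoint (A i)
      (dualUpdate A f g τ σ (s k) i - (s k).y i)‖) atTop (𝓝 0) := fun i => by
    have h1 := tendsto_zero_of_norm_sq_le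
      (fun k => norm_dualUpdate_sub_sq_le (A := A) (f := f) (g := g) hτ hσ hγ (s k) i)
      (by simpa using hdec.const_mul (2 * σ i / (1 - γ)))
    have h2 : Continuous fun d : Y i => ‖(p i)⁻¹ • ContinuousLinearMap.adjoint (A i) d‖ := by
      fun_prop
    have h3 := (h2.tendsto 0).comp h1
    rwa [map_zero, smul_zero, norm_zero] at h3
  have hsum := tendsto_finsetSum Finset.univ fun i _ => hi i
  rw [Finset.sum_const_zero] at hsum
  refine squeeze_zero_norm (fun k => ?_) hsum
  have : s (k + 1) = step A f g τ σ p (a k) (s k) := rfl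
  rw [this, step_zbar_sub_z]
  exact Finset.single_le_sum
    (f := fun i => ‖(p i)⁻¹ • ContinuousLinearMap.adjoint (A i)
      (dualUpdate A f g τ σ (s k) i - (s k).y i)‖)
    (fun i _ => norm_nonneg _) (Finset.mem_univ (a k))

variable [FiniteDimensional ℝ X] [∀ i, FiniteDimensional ℝ (Y i)]

/-- If the decrease of the Lyapunov function vanishes along the iterates, then their cluster
points are fixed points of the proximal updates, hence saddle points. -/
lemma isSaddlePoint_of_cluster (hg : IsGammaZero g) (hf : ∀ i, IsGammaZero (f i))
    (hτ : 0 < τ) (hσ : ∀ i, 0 < σ i) (hγ : γ < 1)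
    (hdec : Tendsto (fun k => decrease A f g τ σ γ (iterate A f g τ σ p x₀ a k)) atTop (𝓝 0))
    {φ : ℕ → ℕ} (hφ : StrictMono φ) {w : X × (∀ i, Y i)}
    (hw : Tendsto (fun k => ((iterate A f g τ σ p x₀ a (φ k)).x,
      (iterate A f g τ σ p x₀ a (φ k)).y)) atTop (𝓝 w)) :
    IsSaddlePoint A f g w := by
  set s := iterate A f g τ σ p x₀ a with hs
  have hφ' := hφ.tendsto_atTop
  have hx : Tendsto (fun k => (s (φ k)).x) atTop (𝓝 w.1) := (continuous_fst.tendsto w).comp hw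
  have hy : ∀ i, Tendsto (fun k => (s (φ k)).y i) atTop (𝓝 (w.2 i)) := fun i =>
    (((continuous_apply i).comp continuous_snd).tendsto w).comp hw
  have hzbar : Tendsto (fun k => (s (φ k)).zbar) atTop
      (𝓝 (∑ i, ContinuousLinearMap.adjoint (A i) (w.2 i))) := by
    have h1 : Tendsto (fun k => (s (φ k)).z) atTop
        (𝓝 (∑ i, ContinuousLinearMap.adjoint (A i) (w.2 i))) := by
      simp_rw [hs, iterate_z]
      exact tendsto_finsetSum _ fun i _ =>
        ((ContinuousLinearMap.adjoint (A i)).continuous.tendsto _).comp (hy i)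
    simpa [hs] using ((tendsto_zbar_sub_z hσ hτ hγ hdec).comp hφ').add h1
  have hdx : Tendsto (fun k => primalUpdate g τ (s (φ k)) - (s (φ k)).x) atTop (𝓝 0) :=
    tendsto_zero_of_norm_sq_le
      (fun k => norm_primalUpdate_sub_sq_le (A := A) (f := f) hτ hσ hγ (s (φ k)))
      (by simpa using (hdec.comp hφ').const_mul (2 * τ / (1 - γ)))
  have hx' : Tendsto (fun k => primalUpdate g τ (s (φ k))) atTop (𝓝 w.1) := by
    simpa using hdx.add hx
  refine (isSaddlePoint_iff_prox hg hf hτ hσ).2 ⟨?_, fun i => ?_⟩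
  · refine tendsto_nhds_unique ?_ hx'
    exact ((hg.continuous_prox hτ).tendsto _).comp (hx.sub (hzbar.const_smul τ))
  · have hdy : Tendsto (fun k => dualUpdate A f g τ σ (s (φ k)) i - (s (φ k)).y i) atTop (𝓝 0) :=
      tendsto_zero_of_norm_sq_le
        (fun k => norm_dualUpdate_sub_sq_le (A := A) (f := f) (g := g) hτ hσ hγ (s (φ k)) i)
        (by simpa using (hdec.comp hφ').const_mul (2 * σ i / (1 - γ)))
    have hy' : Tendsto (fun k => dualUpdate A f g τ σ (s (φ k)) i) atTop (𝓝 (w.2 i)) := by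
      simpa using hdy.add (hy i)
    refine tendsto_nhds_unique ?_ hy'
    exact (((hf i).conj.continuous_prox (hσ i)).tendsto _).comp
      ((hy i).add ((((A i).continuous.tendsto _).comp hx').const_smul (σ i)))

end Iterates

end SPDHG

theorem theorem1 {n : ℕ} {X : Type*} {Y : Fin n → Type*}
    [NormedAddCommGroup X] [InnerProductSpace ℝ X] [CompleteSpace X] [FiniteDimensional ℝ X]
    [∀ i, NormedAddCommGroup (Y i)] [∀ i, InnerProductSpace ℝ (Y i)] [∀ i, CompleteSpace (Y i)]
    [∀ i, FiniteDimensional ℝ (Y i)]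
    (A : ∀ i, X →L[ℝ] Y i) (f : ∀ i, Y i → EReal) (g : X → EReal)
    (τ : ℝ) (σ p : Fin n → ℝ) (x₀ : X)
    (hsol : ∃ w : X × (∀ i, Y i), SPDHG.IsSaddlePoint A f g w)
    (hg_convex : SPDHG.IsConvex g) (hg_proper : SPDHG.IsProper g)
    (hg_lsc : LowerSemicontinuous g)
    (hf_convex : ∀ i, SPDHG.IsConvex (f i)) (hf_proper : ∀ i, SPDHG.IsProper (f i))
    (hf_lsc : ∀ i, LowerSemicontinuous (f i))
    (hτ : 0 < τ) (hσ : ∀ i, 0 < σ i) (hp : ∀ i, 0 < p i)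
    (hstep : ∀ i, τ * σ i * ‖A i‖ ^ 2 < p i)
    {Ω : Type*} [MeasurableSpace Ω] (μ : Measure Ω) [IsProbabilityMeasure μ]
    (j : ℕ → Ω → Fin n) (hj_meas : ∀ k, Measurable (j k)) (hj_indep : iIndepFun j μ)
    (hj_law : ∀ k i, μ (j k ⁻¹' {i}) = ENNReal.ofReal (p i)) :
    ∀ᵐ ω ∂μ, ∃ w : X × (∀ i, Y i), SPDHG.IsSaddlePoint A f g w ∧
      Tendsto
        (fun k => ((SPDHG.iterate A f g τ σ p x₀ (fun m => j m ω) k).x,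
          (SPDHG.iterate A f g τ σ p x₀ (fun m => j m ω) k).y))
        atTop (𝓝 w) := by
  have hg : SPDHG.IsGammaZero g := ⟨hg_convex, hg_proper, hg_lsc⟩
  have hf : ∀ i, SPDHG.IsGammaZero (f i) := fun i => ⟨hf_convex i, hf_proper i, hf_lsc i⟩
  have hp1 : ∑ i, p i = 1 := SPDHG.sum_eq_one (fun i => (hp i).le) hj_meas hj_indep hj_law
  obtain ⟨γ, hγ0, hγ1, hγ⟩ := SPDHG.exists_stepSize_slack hstep
  have := FiniteDimensional.proper_real X
  have := fun i => FiniteDimensional.proper_real (Y i)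
  obtain ⟨C, hCS, hCc, hSC⟩ := (TopologicalSpace.IsSeparable.of_separableSpace
    {w | SPDHG.IsSaddlePoint A f g w}).exists_countable_dense_subset
  have hC : C.Nonempty := by
    obtain ⟨w, hw⟩ := hsol
    exact closure_nonempty_iff.1 ⟨w, hSC hw⟩
  -- countably many reference points share one null set
  have hae : ∀ᵐ ω ∂μ, ∀ w ∈ C,
      (∃ c, Tendsto (fun k => SPDHG.lyapunov τ σ p γ w
        (SPDHG.iterate A f g τ σ p x₀ (fun m => j m ω) k)) atTop (𝓝 c)) ∧
      Tendsto (fun k => SPDHG.decrease A f g τ σ γ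
        (SPDHG.iterate A f g τ σ p x₀ (fun m => j m ω) k)) atTop (𝓝 0) := by
    refine (ae_ball_iff hCc).2 fun w hw => ?_
    refine SPDHG.ae_tendsto_of_average_add_le (fun i => (hp i).le) hj_meas hj_indep hj_law
      (V := fun k a => SPDHG.lyapunov τ σ p γ w (SPDHG.iterate A f g τ σ p x₀ a k))
      (R := fun k a => SPDHG.decrease A f g τ σ γ (SPDHG.iterate A f g τ σ p x₀ a k))
      (fun k a b hab => by simp only [SPDHG.iterate_congr hab])
      (fun k a b hab => by simp only [SPDHG.iterate_congr hab])
      (fun k a => ?_) (fun k a => SPDHG.decrease_nonneg hτ hσ hγ1 _) fun k a => ?_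
    · refine (SPDHG.le_lyapunov hτ hσ hp hγ0 w _).trans' ?_
      have : 0 ≤ 1 - γ := by linarith
      positivity
    · simp only [SPDHG.iterate_update_succ]
      exact SPDHG.sum_lyapunov_step_le hg hf hτ hσ hp hp1 hγ0 hγ (hCS hw) _
        (SPDHG.iterate_z a k)
  filter_upwards [hae] with ω hω
  obtain ⟨w₀, hw₀⟩ := hC
  have hdec := (hω w₀ hw₀).2
  exact SPDHG.exists_tendsto_of_cluster_mem (SPDHG.dist_sq_le_weightedSqDist hτ hσ hp)
    (SPDHG.continuous_weightedSqDist τ σ p) (SPDHG.weightedSqDist_self τ σ p) ⟨w₀, hw₀⟩ hSC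
    (fun w hw => SPDHG.exists_tendsto_weightedSqDist hτ hσ hp hγ0 hγ1
      (SPDHG.tendsto_zbar_sub_z hσ hτ hγ1 hdec) (hω w hw).1)
    fun φ hφ w hw => SPDHG.isSaddlePoint_of_cluster hg hf hτ hσ hγ1 hdec hφ hw
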